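/- Let $r>0$ and $\kappa=1/r$, and let $x,y\in\mathbb R^2$ with $d=\|x-y\|$ satisfying $0<d<2r$. Let $C_1$ and $C_2$ be the two circles of radius $r$ through $x$ and $y$, so that $C_1\cap C_2=\{x,y\}$. A $\kappa$-constrained curve from $x$ to $y$ is an arc-length parametrised curve $\sigma:[0,s]\to\mathbb R^2$, $C^1$ and piecewise $C^2$, with $\sigma(0)=x$, $\sigma(s)=y$ and $\|\sigma''(t)\|\le\kappa$ wherever $\sigma''(t)$ is defined. Let $\Sigma(x,y)$ be the set of these curves with the $C^1$ metric, i.e. the $C^1$ distance on $[0,1]$ between the constant-speed reparametrisations $u\mapsto\sigma(su)$. Two elements of $\Sigma(x,y)$ are $\kappa$-constrained homotopic if they are joined by a continuous path $H:[0,1]\to\Sigma(x,y)$. Then the longer circular arc of $C_1$ from $x$ to $y$ and the longer circular arc of $C_2$ from $x$ to $y$, parametrised by arc length, belong to $\Sigma(x,y)$ and are $\kappa$-constrained homotopic. -/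

import Mathlib

open Set

/-- The Euclidean plane. -/
abbrev Plane : Type := EuclideanSpace ℝ (Fin 2)

/-- The space of `κ`-constrained plane curves from `x` to `y`: arc-length parametrised curves
`σ : [0, s] → ℝ²` with `σ 0 = x` and `σ s = y` that are `C¹`, piecewise `C²`, and satisfy
`‖σ''‖ ≤ κ` on each piece. A curve is stored as a function on all of `ℝ`, extended from `[0, s]` by
the constants `x` and `y`, so that two elements are equal exactly when they agree as curves on
their intervals of definition. All derivatives are taken within the closed intervals, so the
extension plays no role in the conditions. -/
@[ext]
structure ConstrainedCurve (κ : ℝ) (x y : Plane) where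
  /-- The length `s` of the curve. -/
  length : ℝ
  /-- The underlying parametrisation. -/
  toFun : ℝ → Plane
  length_pos : 0 < length
  source : ∀ t ≤ 0, toFun t = x
  target : ∀ t ≥ length, toFun t = y
  contDiffOn : ContDiffOn ℝ 1 toFun (Icc 0 length)
  unit_speed : ∀ t ∈ Icc 0 length, ‖derivWithin toFun (Icc 0 length) t‖ = 1
  piecewise : ∃ (n : ℕ) (τ : ℕ → ℝ), τ 0 = 0 ∧ τ n = length ∧
    ∀ i < n, τ i < τ (i + 1) ∧
      ContDiffOn ℝ 2 toFun (Icc (τ i) (τ (i + 1))) ∧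
      ∀ t ∈ Icc (τ i) (τ (i + 1)),
        ‖iteratedDerivWithin 2 toFun (Icc (τ i) (τ (i + 1))) t‖ ≤ κ

namespace ConstrainedCurve

variable {κ : ℝ} {x y : Plane}

theorem length_mul_mem (σ : ConstrainedCurve κ x y) (u : unitInterval) :
    σ.length * (u : ℝ) ∈ Icc 0 σ.length :=
  ⟨mul_nonneg σ.length_pos.le u.2.1, mul_le_of_le_one_right σ.length_pos.le u.2.2⟩

/-- The constant speed parametrisation `u ↦ σ (s u)` of the curve over `[0, 1]`. -/
def position (σ : ConstrainedCurve κ x y) : C(unitInterval, Plane) where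
  toFun u := σ.toFun (σ.length * (u : ℝ))
  continuous_toFun := σ.contDiffOn.continuousOn.comp_continuous (by fun_prop) σ.length_mul_mem

/-- The derivative `u ↦ s σ' (s u)` of the constant speed parametrisation over `[0, 1]`. -/
noncomputable def velocity (σ : ConstrainedCurve κ x y) : C(unitInterval, Plane) where
  toFun u := σ.length • derivWithin σ.toFun (Icc 0 σ.length) (σ.length * (u : ℝ))
  continuous_toFun :=
    ((σ.contDiffOn.continuousOn_derivWithin (uniqueDiffOn_Icc σ.length_pos)
      le_rfl).comp_continuous (by fun_prop) σ.length_mul_mem).const_smul σ.length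

theorem injective_position_velocity :
    Function.Injective
      (fun σ : ConstrainedCurve κ x y =>
        ((position σ, velocity σ) : C(unitInterval, Plane) × C(unitInterval, Plane))) := by
  intro σ γ h
  have hp : position σ = position γ := congrArg Prod.fst h
  have hv : velocity σ = velocity γ := congrArg Prod.snd h
  have hnorm : ∀ c : ConstrainedCurve κ x y, ‖velocity c 0‖ = c.length := by
    intro c
    change ‖c.length • derivWithin c.toFun (Icc 0 c.length)
      (c.length * ((0 : unitInterval) : ℝ))‖ = c.length
    rw [norm_smul, c.unit_speed _ (c.length_mul_mem 0), mul_one, Real.norm_of_nonneg c.length_pos.le]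
  have hl : σ.length = γ.length := by rw [← hnorm σ, ← hnorm γ, hv]
  refine ConstrainedCurve.ext hl (funext fun t => ?_)
  rcases le_total t 0 with h0 | h0
  · rw [σ.source t h0, γ.source t h0]
  rcases le_total σ.length t with h1 | h1
  · rw [σ.target t h1, γ.target t (hl ▸ h1)]
  · have hs := σ.length_pos
    have hu := DFunLike.congr_fun hp ⟨t / σ.length, div_nonneg h0 hs.le, (div_le_one hs).2 h1⟩
    change σ.toFun (σ.length * (t / σ.length)) = γ.toFun (γ.length * (t / σ.length)) at hu
    rwa [← hl, mul_div_cancel₀ t hs.ne'] at hu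

/-- The `C¹` metric: the maximum of the uniform distances between the constant speed
parametrisations over `[0, 1]` and between their first derivatives. -/
noncomputable instance : MetricSpace (ConstrainedCurve κ x y) :=
  MetricSpace.induced (fun σ => (position σ, velocity σ)) injective_position_velocity inferInstance

/-- Two `κ`-constrained curves from `x` to `y` are `κ`-constrained homotopic if there is a
continuous map `H` from `[0, 1]` to the space of `κ`-constrained curves from `x` to `y`, with the
`C¹` metric, that starts at the first curve and ends at the second. -/
def Homotopic (σ γ : ConstrainedCurve κ x y) : Prop :=
  ∃ H : unitInterval → ConstrainedCurve κ x y, Continuous H ∧ H 0 = σ ∧ H 1 = γ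

/-- The curve `σ` is the longer circular arc, of central angle strictly between `π` and `2π`, in
the circle of centre `a` and radius `r`. It may run in either direction (`ε = 1` or `ε = -1`). -/
def IsLongerArc (a : Plane) (r : ℝ) (σ : ConstrainedCurve κ x y) : Prop :=
  Real.pi * r < σ.length ∧ σ.length < 2 * Real.pi * r ∧
    ∃ θ ε : ℝ, (ε = 1 ∨ ε = -1) ∧ ∀ t ∈ Icc 0 σ.length,
      σ.toFun t = a + r • !₂[Real.cos (θ + ε * (t / r)), Real.sin (θ + ε * (t / r))]

end ConstrainedCurve

/-! A unit speed curve is determined by its starting point and its tangent angle. A piecewise affine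
angle with slopes at most `κ` in modulus gives a constrained curve, and a family whose lengths and
angles vary continuously is continuous in the `C¹` metric (`continuous_ofAngle`). It suffices to
move through finitely many real parameters.

Both longer arcs have the same central angle `ω ∈ (π, 2π)`, in units where `r = 1`. They turn in
opposite directions, and the direction `φ` in which the left arc arrives at `y` is the direction in
which the right arc leaves `x`. Both are thus extreme cases of curves segment, left turn `P`,
segment, right turn `Q`, segment, whose middle segment has the fixed direction `φ`; closing up at
`y` is two real equations (`biarcParams`).

These parameters are joined in `joinedIn_biarcParams`. The left turn is shortened from `ω` to `R =
(π + ω) / 2`, the right turn is grown from `0` to `R`, and then, both turns being equal, length is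
transferred from the first segment to the last. Reversing the order of the tangent angles gives the
rest of the path. Turns beyond `π` make `sin P` negative, which keeps the segment lengths finite and
nonnegative. -/

/-- The function `θ` is continuous-piecewise affine on `[a, b]`, with slopes of modulus at most `κ`.
The degenerate interval `a = b` is allowed. -/
def PiecewiseAffine (κ : ℝ) (θ : ℝ → ℝ) (a b : ℝ) : Prop :=
  ∃ (n : ℕ) (τ : ℕ → ℝ), τ 0 = a ∧ τ n = b ∧
    ∀ i < n, τ i < τ (i + 1) ∧ ∃ α β : ℝ, |β| ≤ κ ∧
      ∀ t ∈ Icc (τ i) (τ (i + 1)), θ t = α + β * t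

namespace PiecewiseAffine

variable {κ a b c : ℝ} {θ : ℝ → ℝ}

theorem of_affine (hab : a ≤ b) (α β : ℝ) (hβ : |β| ≤ κ)
    (h : ∀ t ∈ Icc a b, θ t = α + β * t) : PiecewiseAffine κ θ a b := by
  rcases hab.eq_or_lt with rfl | hab
  -- Pieces must have positive length, so a degenerate interval has none.
  · exact ⟨0, fun _ => a, rfl, rfl, by simp⟩
  · refine ⟨1, fun i => if i = 0 then a else b, by simp, by simp, fun i hi => ?_⟩
    obtain rfl : i = 0 := by omega
    simpa using ⟨hab, α, β, hβ, fun t h1 h2 => h t ⟨h1, h2⟩⟩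

theorem trans (h₁ : PiecewiseAffine κ θ a b) (h₂ : PiecewiseAffine κ θ b c) :
    PiecewiseAffine κ θ a c := by
  obtain ⟨n, τ, h0, hn, h⟩ := h₁
  obtain ⟨m, τ', h0', hm, h'⟩ := h₂
  refine ⟨n + m, fun i => if i ≤ n then τ i else τ' (i - n), by simp [h0], ?_, fun i hi => ?_⟩
  · rcases Nat.eq_zero_or_pos m with rfl | hpos
    · simp [hn, ← hm, h0']
    · simp [hm, hpos.ne']
  · rcases lt_trichotomy i n with hin | rfl | hin
    · simpa [hin.le, Nat.succ_le_of_lt hin] using h i hin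
    -- At the junction, index `n` still reads `τ` while `n + 1` reads `τ' 1`; the two match because
    -- `τ n = b = τ' 0`.
    · have := h' 0 (by omega)
      simpa [hn, ← h0'] using this
    · have h1 : ¬ i ≤ n := by omega
      have h2 : ¬ i + 1 ≤ n := by omega
      have h3 : i + 1 - n = i - n + 1 := by omega
      simpa only [h1, h2, if_false, h3] using h' (i - n) (by omega)

end PiecewiseAffine

/-! ### Curves with prescribed tangent angle -/

/-- The standard isometry between the complex plane and the Euclidean plane. -/
noncomputable def complexPlane : ℂ ≃ₗᵢ[ℝ] Plane := Complex.orthonormalBasisOneI.repr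

theorem complexPlane_apply (z : ℂ) : complexPlane z = !₂[z.re, z.im] := by
  ext i
  fin_cases i <;> simp [complexPlane]

/-- The unit speed plane curve from `x` whose tangent at time `t` has angle `θ t`. -/
noncomputable def angleCurve (x : Plane) (θ : ℝ → ℝ) (t : ℝ) : Plane :=
  x + complexPlane (∫ v in (0 : ℝ)..t, Complex.exp (θ v * Complex.I))

section angleCurve

variable {κ : ℝ} {x y : Plane} {θ : ℝ → ℝ}

theorem hasDerivAt_angleCurve (hθ : Continuous θ) (t : ℝ) :
    HasDerivAt (angleCurve x θ) (complexPlane (Complex.exp (θ t * Complex.I))) t := by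
  have hc : Continuous fun v => Complex.exp (θ v * Complex.I) := by fun_prop
  have h := intervalIntegral.integral_hasDerivAt_right (hc.intervalIntegrable 0 t)
    (hc.stronglyMeasurableAtFilter _ _) hc.continuousAt
  exact (complexPlane.toContinuousLinearEquiv.toContinuousLinearMap.hasFDerivAt.comp_hasDerivAt t
    h).const_add x

theorem derivWithin_angleCurve (hθ : Continuous θ) {a b t : ℝ} (hab : a < b) (ht : t ∈ Icc a b) :
    derivWithin (angleCurve x θ) (Icc a b) t = complexPlane (Complex.exp (θ t * Complex.I)) :=
  (hasDerivAt_angleCurve hθ t).hasDerivWithinAt.derivWithin (uniqueDiffOn_Icc hab t ht)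

theorem contDiffOn_one_angleCurve (hθ : Continuous θ) {a b : ℝ} (hab : a < b) :
    ContDiffOn ℝ 1 (angleCurve x θ) (Icc a b) := by
  rw [contDiffOn_one_iff_derivWithin (uniqueDiffOn_Icc hab)]
  refine ⟨fun t _ => (hasDerivAt_angleCurve hθ t).differentiableAt.differentiableWithinAt, ?_⟩
  refine ContinuousOn.congr (f := fun t => complexPlane (Complex.exp (θ t * Complex.I))) ?_
    fun t ht => derivWithin_angleCurve hθ hab ht
  exact (complexPlane.continuous.comp (by fun_prop)).continuousOn

theorem hasDerivAt_complexPlane_exp (α β t : ℝ) :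
    HasDerivAt (fun t : ℝ => complexPlane (Complex.exp ((α + β * t : ℝ) * Complex.I)))
      (complexPlane (Complex.exp ((α + β * t : ℝ) * Complex.I) * (β * Complex.I))) t := by
  have h : HasDerivAt (fun t : ℝ => α + β * t) β t := by
    simpa using ((hasDerivAt_id t).const_mul β).const_add α
  exact complexPlane.toContinuousLinearEquiv.toContinuousLinearMap.hasFDerivAt.comp_hasDerivAt t
    (h.ofReal_comp.mul_const Complex.I).cexp

/-- The derivative is the unit vector of angle `α + β t`, so curvature is the slope of the angle. -/
theorem contDiffOn_two_angleCurve (hθ : Continuous θ) {a b α β : ℝ} (hab : a < b)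
    (h : ∀ t ∈ Icc a b, θ t = α + β * t) :
    ContDiffOn ℝ 2 (angleCurve x θ) (Icc a b) ∧
      ∀ t ∈ Icc a b, ‖iteratedDerivWithin 2 (angleCurve x θ) (Icc a b) t‖ = |β| := by
  have hu := uniqueDiffOn_Icc hab
  have hd : EqOn (derivWithin (angleCurve x θ) (Icc a b))
      (fun t : ℝ => complexPlane (Complex.exp ((α + β * t : ℝ) * Complex.I))) (Icc a b) :=
    fun t ht => by rw [derivWithin_angleCurve hθ hab ht, h t ht]
  constructor
  · rw [show (2 : WithTop ℕ∞) = 1 + 1 by norm_num, contDiffOn_succ_iff_derivWithin hu]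
    refine ⟨fun t _ => (hasDerivAt_angleCurve hθ t).differentiableAt.differentiableWithinAt,
      by simp, ContDiffOn.congr ?_ hd⟩
    refine ContDiff.contDiffOn ?_
    refine complexPlane.toContinuousLinearEquiv.contDiff.comp (ContDiff.cexp ?_)
    exact (Complex.ofRealCLM.contDiff.comp (contDiff_const.add (contDiff_const.mul contDiff_id))).mul
      contDiff_const
  · intro t ht
    have h2 : iteratedDerivWithin 2 (angleCurve x θ) (Icc a b) t =
      derivWithin (iteratedDerivWithin 1 (angleCurve x θ) (Icc a b)) (Icc a b) t :=
        congrFun iteratedDerivWithin_succ t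
    rw [h2, iteratedDerivWithin_one, derivWithin_congr hd (hd ht),
      (hasDerivAt_complexPlane_exp α β t).hasDerivWithinAt.derivWithin (hu t ht),
      LinearIsometryEquiv.norm_map, norm_mul, Complex.norm_exp_ofReal_mul_I]
    simp

namespace ConstrainedCurve

/-- The constrained curve from `x` to `y` with piecewise affine tangent angle `θ`. -/
noncomputable def ofAngle (x y : Plane) {κ l : ℝ} (θ : ℝ → ℝ) (hl : 0 < l) (hθ : Continuous θ)
    (hκ : PiecewiseAffine κ θ 0 l) (hy : angleCurve x θ l = y) : ConstrainedCurve κ x y where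
  length := l
  toFun t := angleCurve x θ (max 0 (min t l))
  length_pos := hl
  source t ht := by simp [ht, ht.trans hl.le, angleCurve]
  target t ht := by simp [ge_iff_le.1 ht, hl.le, hy]
  contDiffOn := (contDiffOn_one_angleCurve (x := x) hθ hl).congr fun t ht => by simp [ht.1, ht.2]
  unit_speed t ht := by
    rw [derivWithin_congr (f := angleCurve x θ) (fun t ht => by simp [ht.1, ht.2])
      (by simp only [min_eq_left ht.2, max_eq_right ht.1]), derivWithin_angleCurve hθ hl ht, LinearIsometryEquiv.norm_map,
      Complex.norm_exp_ofReal_mul_I]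
  piecewise := by
    obtain ⟨n, τ, h0, hn, h⟩ := hκ
    refine ⟨n, τ, h0, hn, fun i hi => ?_⟩
    obtain ⟨hlt, α, β, hβ, hαβ⟩ := h i hi
    have hmono : ∀ j k, j ≤ k → k ≤ n → τ j ≤ τ k := by
      intro j k hjk
      induction k, hjk using Nat.le_induction with
      | base => exact fun _ => le_rfl
      | succ k hk ih => exact fun hkn => (ih (by omega)).trans (h k (by omega)).1.le
    have heq : EqOn (fun t => angleCurve x θ (max 0 (min t l))) (angleCurve x θ)
        (Icc (τ i) (τ (i + 1))) := by
      intro t ht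
      have h1 : 0 ≤ t := h0 ▸ (hmono 0 i (by omega) hi.le).trans ht.1
      have h2 : t ≤ l := hn ▸ ht.2.trans (hmono (i + 1) n hi le_rfl)
      simp [h1, h2]
    have h2 := contDiffOn_two_angleCurve (x := x) hθ hlt hαβ
    refine ⟨hlt, h2.1.congr heq, fun t ht => ?_⟩
    rw [iteratedDerivWithin_congr heq ht, h2.2 t ht]
    exact hβ

theorem ofAngle_toFun {κ l : ℝ} {hl : 0 < l} {hθ : Continuous θ}
    {hκ : PiecewiseAffine κ θ 0 l} {hy : angleCurve x θ l = y} {t : ℝ} (ht : t ∈ Icc 0 l) :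
    (ofAngle x y θ hl hθ hκ hy).toFun t = angleCurve x θ t := by
  simp [ofAngle, ht.1, ht.2]

theorem position_ofAngle {κ l : ℝ} {hl : 0 < l} {hθ : Continuous θ}
    {hκ : PiecewiseAffine κ θ 0 l} {hy : angleCurve x θ l = y} (u : unitInterval) :
    (ofAngle x y θ hl hθ hκ hy).position u = angleCurve x θ (l * u) :=
  ofAngle_toFun (hl := hl) (hθ := hθ) (hκ := hκ) (hy := hy) (length_mul_mem _ u)

theorem velocity_ofAngle {κ l : ℝ} {hl : 0 < l} {hθ : Continuous θ}
    {hκ : PiecewiseAffine κ θ 0 l} {hy : angleCurve x θ l = y} (u : unitInterval) :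
    (ofAngle x y θ hl hθ hκ hy).velocity u =
      l • complexPlane (Complex.exp (θ (l * u) * Complex.I)) := by
  have hu : l * (u : ℝ) ∈ Icc 0 l := (ofAngle x y θ hl hθ hκ hy).length_mul_mem u
  change l • derivWithin (ofAngle x y θ hl hθ hκ hy).toFun (Icc 0 l) (l * (u : ℝ)) = _
  have he : EqOn (ofAngle x y θ hl hθ hκ hy).toFun (angleCurve x θ) (Icc 0 l) :=
    fun t ht => ofAngle_toFun ht
  rw [derivWithin_congr he (he hu), derivWithin_angleCurve hθ hl hu]

/-- A family of curves with jointly continuous tangent angles is continuous in the `C¹` metric. -/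
theorem continuous_ofAngle {X : Type*} [TopologicalSpace X] {l : X → ℝ} {θ : X → ℝ → ℝ}
    (hl : ∀ p, 0 < l p) (hlc : Continuous l) (hθ : Continuous (Function.uncurry θ))
    (hκ : ∀ p, PiecewiseAffine κ (θ p) 0 (l p)) (hy : ∀ p, angleCurve x (θ p) (l p) = y) :
    Continuous fun p => ofAngle x y (θ p) (hl p) (hθ.uncurry_left p) (hκ p) (hy p) := by
  have hi : Topology.IsInducing (fun σ : ConstrainedCurve κ x y =>
      ((position σ, velocity σ) : C(unitInterval, Plane) × C(unitInterval, Plane))) := ⟨rfl⟩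
  rw [hi.continuous_iff]
  have hm : Continuous fun q : X × unitInterval => l q.1 * (q.2 : ℝ) := by fun_prop
  -- The metric is induced by position and velocity, so joint continuity of each in parameter and
  -- time is enough.
  refine Continuous.prodMk (ContinuousMap.continuous_of_continuous_uncurry _ ?_)
    (ContinuousMap.continuous_of_continuous_uncurry _ ?_)
  · refine Continuous.congr (f := fun q : X × unitInterval =>
      angleCurve x (θ q.1) (l q.1 * (q.2 : ℝ))) ?_ fun q => (position_ofAngle q.2).symm
    refine continuous_const.add (complexPlane.continuous.comp ?_)
    refine intervalIntegral.continuous_parametric_intervalIntegral_of_continuous ?_ hm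
    have : Continuous fun z : (X × unitInterval) × ℝ => θ z.1.1 z.2 :=
      hθ.comp (f := fun z : (X × unitInterval) × ℝ => (z.1.1, z.2)) (by fun_prop)
    exact Complex.continuous_exp.comp ((Complex.continuous_ofReal.comp this).mul continuous_const)
  · refine Continuous.congr (f := fun q : X × unitInterval =>
      l q.1 • complexPlane (Complex.exp (θ q.1 (l q.1 * (q.2 : ℝ)) * Complex.I))) ?_
      fun q => (velocity_ofAngle q.2).symm
    have : Continuous fun q : X × unitInterval => θ q.1 (l q.1 * (q.2 : ℝ)) :=
      hθ.comp (f := fun q : X × unitInterval => (q.1, l q.1 * (q.2 : ℝ))) (by fun_prop)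
    refine (hlc.comp continuous_fst).smul (complexPlane.continuous.comp ?_)
    exact Complex.continuous_exp.comp ((Complex.continuous_ofReal.comp this).mul continuous_const)

end ConstrainedCurve

end angleCurve

/-! ### The parameter space and a path in it -/

/-- The parameters `(A, P, B, Q, C)` of the curves of unit curvature radius that run straight for
`A`, turn left by `P`, run straight for `B`, turn right by `Q` and run straight for `C`, and whose
endpoints, relative to the direction of the middle segment, differ as those of a circular arc of
angle `ω` do. -/
def biarcParams (ω : ℝ) : Set (ℝ × ℝ × ℝ × ℝ × ℝ) :=
  {p | 0 ≤ p.1 ∧ 0 ≤ p.2.1 ∧ 0 ≤ p.2.2.1 ∧ 0 ≤ p.2.2.2.1 ∧ 0 ≤ p.2.2.2.2 ∧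
    p.1 * Real.cos p.2.1 + p.2.2.2.2 * Real.cos p.2.2.2.1 + p.2.2.1 + Real.sin p.2.1
      + Real.sin p.2.2.2.1 = Real.sin ω ∧
    p.1 * Real.sin p.2.1 + p.2.2.2.2 * Real.sin p.2.2.2.1 + 2 - Real.cos p.2.1
      - Real.cos p.2.2.2.1 = 1 - Real.cos ω}

section biarcParams

variable {ω : ℝ}

theorem mem_biarcParams {A P B Q C : ℝ} : (A, P, B, Q, C) ∈ biarcParams ω ↔
    0 ≤ A ∧ 0 ≤ P ∧ 0 ≤ B ∧ 0 ≤ Q ∧ 0 ≤ C ∧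
    A * Real.cos P + C * Real.cos Q + B + Real.sin P + Real.sin Q = Real.sin ω ∧
    A * Real.sin P + C * Real.sin Q + 2 - Real.cos P - Real.cos Q = 1 - Real.cos ω := Iff.rfl

theorem sin_neg_of_mem_Ioo {P : ℝ} (h₁ : Real.pi < P) (h₂ : P < 2 * Real.pi) : Real.sin P < 0 := by
  have := Real.sin_pos_of_pos_of_lt_pi (x := P - Real.pi) (by linarith) (by linarith)
  rw [Real.sin_sub_pi] at this
  linarith

theorem cos_le_cos_of_pi_le {P Q : ℝ} (h₁ : Real.pi ≤ P) (h₂ : P ≤ Q) (h₃ : Q ≤ 2 * Real.pi) :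
    Real.cos P ≤ Real.cos Q := by
  rw [← Real.cos_two_pi_sub P, ← Real.cos_two_pi_sub Q]
  exact Real.cos_le_cos_of_nonneg_of_le_pi (by linarith) (by linarith) (by linarith)

/-- The lengths of the segments are determined by the turning angles when the last one vanishes. -/
theorem mem_biarcParams_of_angles {P Q : ℝ} (hP₁ : Real.pi < P) (hP₂ : P ≤ ω)
    (hω : ω < 2 * Real.pi) (hQ : 0 ≤ Q)
    (h : Real.cos P + Real.cos (ω - P) ≤ 1 + Real.cos (P - Q)) :
    ((1 - Real.cos Q + (Real.cos ω - Real.cos P)) / -Real.sin P, P,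
      (1 - Real.cos P - Real.cos (ω - P) + Real.cos (P - Q)) / -Real.sin P, Q, 0)
      ∈ biarcParams ω := by
  have hs : Real.sin P < 0 := sin_neg_of_mem_Ioo hP₁ (hP₂.trans_lt hω)
  have hs' : Real.sin P ≠ 0 := hs.ne
  -- This makes the first segment nonnegative; hypothesis `h` does so for the middle one.
  have hc := cos_le_cos_of_pi_le hP₁.le hP₂ hω.le
  have hcQ := Real.cos_le_one Q
  refine mem_biarcParams.2 ⟨div_nonneg (by linarith) (by linarith), by linarith [Real.pi_pos],
    div_nonneg (by linarith) (by linarith), hQ, le_rfl, ?_, ?_⟩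
  · rw [Real.cos_sub, Real.cos_sub]
    field_simp
    linear_combination Real.sin_sq_add_cos_sq P
  · field_simp
    ring

/-- Running through the tangent angles in reverse order exchanges the two turns and preserves their
integral, the displacement. -/
theorem swap_mem_biarcParams {A P B Q C : ℝ} (h : (A, P, B, Q, C) ∈ biarcParams ω) :
    (C, Q, B, P, A) ∈ biarcParams ω := by
  rw [mem_biarcParams] at h ⊢
  obtain ⟨h1, h2, h3, h4, h5, h6, h7⟩ := h
  exact ⟨h5, h4, h3, h2, h1, by linarith, by linarith⟩

/-- The two extreme parameters, for the left and the right turning arc, are joined. -/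
theorem joinedIn_biarcParams (h₁ : Real.pi < ω) (h₂ : ω < 2 * Real.pi) :
    JoinedIn (biarcParams ω) (0, ω, 0, 0, 0) (0, 0, 0, ω, 0) := by
  have hpi := Real.pi_pos
  set R : ℝ := (Real.pi + ω) / 2 with hR
  have hR₁ : Real.pi < R := by linarith
  have hR₂ : R < ω := by linarith
  set f : ℝ → ℝ → ℝ × ℝ × ℝ × ℝ × ℝ := fun P Q =>
    ((1 - Real.cos Q + (Real.cos ω - Real.cos P)) / -Real.sin P, P,
      (1 - Real.cos P - Real.cos (ω - P) + Real.cos (P - Q)) / -Real.sin P, Q, 0) with hf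
  -- At the midpoint `R` of `π` and `ω` the two cosines cancel, so the middle segment stays
  -- nonnegative for every `Q`.
  have key : Real.cos R + Real.cos (ω - R) ≤ 0 := by
    have : ω - R = R - Real.pi := by rw [hR]; ring
    rw [this, Real.cos_sub_pi]
    linarith
  have hRQ : ∀ Q, 0 ≤ Q → f R Q ∈ biarcParams ω := fun Q hQ =>
    mem_biarcParams_of_angles hR₁ hR₂.le h₂ hQ (by linarith [Real.neg_one_le_cos (R - Q)])
  -- Shorten the left turn to `R`; for `Q = 0` the condition on the middle segment is only `cos (ω -
  -- P) ≤ 1`.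
  have s1 : JoinedIn (biarcParams ω) (0, ω, 0, 0, 0) (f R 0) := by
    have hsub : ∀ s ∈ unitInterval, R ≤ ω + s * (R - ω) ∧ ω + s * (R - ω) ≤ ω := fun s hs =>
      ⟨by nlinarith [hs.2], by nlinarith [hs.1]⟩
    refine JoinedIn.ofLine (f := fun s => f (ω + s * (R - ω)) 0) ?_ ?_ ?_ ?_
    · have hne : ∀ s ∈ unitInterval, -Real.sin (ω + s * (R - ω)) ≠ 0 := fun s hs =>
        neg_ne_zero.2 (sin_neg_of_mem_Ioo (hR₁.trans_le (hsub s hs).1)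
          ((hsub s hs).2.trans_lt h₂)).ne
      refine ContinuousOn.prodMk (ContinuousOn.div (by fun_prop) (by fun_prop) hne)
        (ContinuousOn.prodMk (by fun_prop) (ContinuousOn.prodMk
          (ContinuousOn.div (by fun_prop) (by fun_prop) hne) (by fun_prop)))
    · simp [hf]
    · simp [hf]
    · rintro _ ⟨s, hs, rfl⟩
      refine mem_biarcParams_of_angles (hR₁.trans_le (hsub s hs).1) (hsub s hs).2 h₂ le_rfl ?_
      rw [sub_zero]
      linarith [Real.cos_le_one (ω - (ω + s * (R - ω)))]
  have s2 : JoinedIn (biarcParams ω) (f R 0) (f R R) := by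
    have hne : -Real.sin R ≠ 0 := neg_ne_zero.2 (sin_neg_of_mem_Ioo hR₁ (hR₂.trans h₂)).ne
    refine JoinedIn.ofLine (f := fun s => f R (s * R)) ?_ (by simp) (by simp) ?_
    · refine Continuous.continuousOn ?_
      simp only [hf]
      fun_prop
    · rintro _ ⟨s, hs, rfl⟩
      exact hRQ _ (mul_nonneg hs.1 (by linarith))
  have hswap : Continuous fun p : ℝ × ℝ × ℝ × ℝ × ℝ =>
    (p.2.2.2.2, p.2.2.2.1, p.2.2.1, p.2.1, p.1) := by fun_prop
  have hswap' : (fun p : ℝ × ℝ × ℝ × ℝ × ℝ => (p.2.2.2.2, p.2.2.2.1, p.2.2.1, p.2.1, p.1)) ''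
      biarcParams ω ⊆ biarcParams ω := by
    rintro _ ⟨⟨A, P, B, Q, C⟩, hp, rfl⟩
    exact swap_mem_biarcParams hp
  have s4 := ((s1.trans s2).map hswap).mono hswap'
  -- What remains joins `f R R` to its swap. With equal turns the equations involve only `A + C`, so
  -- the length `K` moves linearly from one end to the other.
  refine ((s1.trans s2).trans ?_).trans s4.symm
  have hm := mem_biarcParams.1 (hRQ R (by linarith))
  simp only [hf]
  generalize (1 - Real.cos R + (Real.cos ω - Real.cos R)) / -Real.sin R = K at hm ⊢
  generalize (1 - Real.cos R - Real.cos (ω - R) + Real.cos (R - R)) / -Real.sin R = B at hm ⊢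
  obtain ⟨h1, h2, h3, h4, h5, h6, h7⟩ := hm
  refine JoinedIn.ofLine (f := fun s => ((1 - s) * K, R, B, R, s * K)) (by fun_prop)
    (by simp) (by simp) ?_
  rintro _ ⟨s, hs, rfl⟩
  exact mem_biarcParams.2 ⟨mul_nonneg (by linarith [hs.2]) h1, h2, h3, h4, mul_nonneg hs.1 h1,
    by linarith, by linarith⟩

end biarcParams

/-! ### Integrals and chords of the complex exponential -/

section exp

open Complex

theorem integral_exp_mul_I_of_const {θ : ℝ → ℝ} {a b α : ℝ} (hab : a ≤ b)
    (h : ∀ t ∈ Icc a b, θ t = α) :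
    ∫ t in a..b, exp (θ t * I) = (b - a) * exp (α * I) := by
  rw [intervalIntegral.integral_congr (g := fun _ => exp (α * I))
    fun t ht => by rw [uIcc_of_le hab] at ht; simp only [h t ht]]
  simp

theorem integral_exp_mul_I_of_affine {θ : ℝ → ℝ} {a b α β : ℝ} (hab : a ≤ b) (hβ : β ≠ 0)
    (h : ∀ t ∈ Icc a b, θ t = α + β * t) :
    ∫ t in a..b, exp (θ t * I) = (exp (θ b * I) - exp (θ a * I)) / (β * I) := by
  have hβ' : (β : ℂ) * I ≠ 0 := mul_ne_zero (ofReal_ne_zero.2 hβ) I_ne_zero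
  have he : ∀ t ∈ Icc a b, exp (θ t * I) = exp (α * I) * exp (β * I * t) := fun t ht => by
    rw [h t ht, ← exp_add]
    congr 1
    push_cast
    ring
  rw [intervalIntegral.integral_congr (g := fun t : ℝ => exp (α * I) * exp (β * I * t))
    fun t ht => by rw [uIcc_of_le hab] at ht; exact he t ht,
    intervalIntegral.integral_const_mul, integral_exp_mul_complex hβ',
    he b (right_mem_Icc.2 hab), he a (left_mem_Icc.2 hab)]
  ring

theorem cos_eq_of_norm_exp_sub_one_eq {a b : ℝ} (h : ‖exp (a * I) - 1‖ = ‖exp (b * I) - 1‖) :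
    Real.cos a = Real.cos b := by
  have key : ∀ c : ℝ, ‖exp (c * I) - 1‖ ^ 2 = 2 - 2 * Real.cos c := fun c => by
    rw [← normSq_eq_norm_sq, normSq_apply, sub_re, sub_im, exp_ofReal_mul_I_re,
      exp_ofReal_mul_I_im]
    simp only [one_re, one_im]
    linear_combination Real.sin_sq_add_cos_sq c
  have := key a
  rw [h, key b] at this
  linarith

theorem complexPlane_mul_exp (r α : ℝ) :
    complexPlane (r * exp (α * I)) = r • !₂[Real.cos α, Real.sin α] := by
  rw [← real_smul, map_smul, complexPlane_apply, exp_ofReal_mul_I_re, exp_ofReal_mul_I_im]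

end exp

/-! ### From parameters to curves -/

/-- The angle, relative to the middle segment, of the tangent of the curve with parameters
`(A, P, B, Q, C)` after length `u`. -/
def biarcAngle (p : ℝ × ℝ × ℝ × ℝ × ℝ) (u : ℝ) : ℝ :=
  min (max (u - p.1) 0) p.2.1 - min (max (u - (p.1 + p.2.1 + p.2.2.1)) 0) p.2.2.2.1 - p.2.1

/-- The length of the curve with parameters `(A, P, B, Q, C)`. -/
def biarcLength (p : ℝ × ℝ × ℝ × ℝ × ℝ) : ℝ :=
  p.1 + p.2.1 + p.2.2.1 + p.2.2.2.1 + p.2.2.2.2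

section biarc

variable {A P B Q C ω : ℝ}

/-- The formula by clamped ramps gives continuity in the parameters as well, including where pieces
shrink to length zero. -/
theorem continuous_biarcAngle : Continuous (Function.uncurry biarcAngle) := by
  unfold Function.uncurry biarcAngle
  fun_prop

theorem continuous_biarcLength : Continuous biarcLength := by
  unfold biarcLength
  fun_prop

/-- The five affine pieces of the tangent angle. -/
theorem biarcAngle_pieces (hP : 0 ≤ P) (hB : 0 ≤ B) (hQ : 0 ≤ Q) :
    (∀ u ∈ Icc 0 A, biarcAngle (A, P, B, Q, C) u = -P) ∧
    (∀ u ∈ Icc A (A + P), biarcAngle (A, P, B, Q, C) u = -P - A + 1 * u) ∧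
    (∀ u ∈ Icc (A + P) (A + P + B), biarcAngle (A, P, B, Q, C) u = 0) ∧
    (∀ u ∈ Icc (A + P + B) (A + P + B + Q),
      biarcAngle (A, P, B, Q, C) u = A + P + B + (-1) * u) ∧
    (∀ u ∈ Icc (A + P + B + Q) (A + P + B + Q + C), biarcAngle (A, P, B, Q, C) u = -Q) := by
  simp only [biarcAngle]
  refine ⟨?_, ?_, ?_, ?_, ?_⟩ <;> rintro u ⟨h1, h2⟩
  · rw [max_eq_right (by linarith), max_eq_right (by linarith), min_eq_left hP, min_eq_left hQ]
    ring
  · rw [max_eq_left (by linarith), max_eq_right (by linarith), min_eq_left (by linarith),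
      min_eq_left hQ]
    ring
  · rw [max_eq_left (by linarith), max_eq_right (by linarith), min_eq_right (by linarith),
      min_eq_left hQ]
    ring
  · rw [max_eq_left (by linarith), max_eq_left (by linarith), min_eq_right (by linarith),
      min_eq_left (by linarith)]
    ring
  · rw [max_eq_left (by linarith), max_eq_left (by linarith), min_eq_right (by linarith),
      min_eq_right (by linarith)]
    ring

/-- Rescaling time by `r` turns the slopes `0`, `1`, `-1` into `0`, `1 / r`, `-1 / r`. -/
theorem piecewiseAffine_biarcAngle {r : ℝ} (hr : 0 < r) (φ : ℝ) {p : ℝ × ℝ × ℝ × ℝ × ℝ}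
    (hp : p ∈ biarcParams ω) :
    PiecewiseAffine (1 / r) (fun t => φ + biarcAngle p (t / r)) 0 (r * biarcLength p) := by
  obtain ⟨A, P, B, Q, C⟩ := p
  obtain ⟨hA, hP, hB, hQ, hC, -, -⟩ := mem_biarcParams.1 hp
  obtain ⟨e1, e2, e3, e4, e5⟩ := biarcAngle_pieces (A := A) (C := C) hP hB hQ
  have hdiv : ∀ {a b t : ℝ}, t ∈ Icc (r * a) (r * b) → t / r ∈ Icc a b := fun ht =>
    ⟨(le_div_iff₀ hr).2 (by linarith [ht.1]), (div_le_iff₀ hr).2 (by linarith [ht.2])⟩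
  have piece : ∀ {a b : ℝ} (α β : ℝ), a ≤ b → |β| ≤ 1 →
      (∀ u ∈ Icc a b, biarcAngle (A, P, B, Q, C) u = α + β * u) →
      PiecewiseAffine (1 / r) (fun t => φ + biarcAngle (A, P, B, Q, C) (t / r)) (r * a) (r * b) := by
    intro a b α β hab hβ h
    refine .of_affine (mul_le_mul_of_nonneg_left hab hr.le) (φ + α) (β / r) ?_ fun t ht => ?_
    · rw [abs_div, abs_of_pos hr]
      exact div_le_div_of_nonneg_right hβ hr.le
    · rw [h _ (hdiv ht)]
      ring
  have q1 := piece (-P) 0 hA (by simp) (by simpa using e1)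
  have q2 := piece (-P - A) 1 (by linarith) (by simp) e2
  have q3 := piece (a := A + P) (b := A + P + B) 0 0 (by linarith) (by simp) (by simpa using e3)
  have q4 := piece (A + P + B) (-1) (by linarith) (by simp) e4
  have q5 := piece (a := A + P + B + Q) (b := A + P + B + Q + C) (-Q) 0 (by linarith) (by simp) (by simpa using e5)
  have := (((q1.trans q2).trans q3).trans q4).trans q5
  rwa [mul_zero] at this

-- The right-hand side is the displacement both of a left turn from angle `-ω` to `0` and of a right
-- turn from `0` to `-ω`. The equations of `biarcParams` are its real part and the negative of its
-- imaginary part.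
open Complex in
theorem integral_biarcAngle {p : ℝ × ℝ × ℝ × ℝ × ℝ} (hp : p ∈ biarcParams ω) :
    ∫ u in (0 : ℝ)..biarcLength p, exp (biarcAngle p u * I) = (1 - exp (-ω * I)) / I := by
  obtain ⟨A, P, B, Q, C⟩ := p
  obtain ⟨hA, hP, hB, hQ, hC, hre, him⟩ := mem_biarcParams.1 hp
  obtain ⟨e1, e2, e3, e4, e5⟩ := biarcAngle_pieces (A := A) (C := C) hP hB hQ
  have hc : Continuous fun u : ℝ => exp (biarcAngle (A, P, B, Q, C) u * I) := by
    have := continuous_biarcAngle.uncurry_left (A, P, B, Q, C)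
    fun_prop
  have hi : ∀ a b : ℝ, IntervalIntegrable (fun u : ℝ => exp (biarcAngle (A, P, B, Q, C) u * I))
      MeasureTheory.volume a b := fun a b => hc.intervalIntegrable a b
  change ∫ u in (0 : ℝ)..(A + P + B + Q + C), _ = _
  rw [← intervalIntegral.integral_add_adjacent_intervals (hi 0 (A + P + B + Q)) (hi _ _),
    ← intervalIntegral.integral_add_adjacent_intervals (hi 0 (A + P + B)) (hi _ _),
    ← intervalIntegral.integral_add_adjacent_intervals (hi 0 (A + P)) (hi _ _),
    ← intervalIntegral.integral_add_adjacent_intervals (hi 0 A) (hi _ _),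
    integral_exp_mul_I_of_const hA e1, integral_exp_mul_I_of_affine (by linarith) one_ne_zero e2,
    integral_exp_mul_I_of_const (by linarith) e3,
    integral_exp_mul_I_of_affine (by linarith) (by norm_num) e4,
    integral_exp_mul_I_of_const (by linarith) e5,
    e1 A ⟨hA, le_rfl⟩, e3 (A + P) ⟨le_rfl, by linarith⟩, e3 (A + P + B) ⟨by linarith, le_rfl⟩,
    e5 (A + P + B + Q) ⟨le_rfl, by linarith⟩]
  rw [← ofReal_neg ω]
  simp only [exp_mul_I, ← ofReal_cos, ← ofReal_sin, Real.cos_neg, Real.sin_neg, Real.cos_zero,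
    Real.sin_zero]
  have hre' : (A : ℂ) * Real.cos P + C * Real.cos Q + B + Real.sin P + Real.sin Q = Real.sin ω :=
    mod_cast hre
  have him' : (A : ℂ) * Real.sin P + C * Real.sin Q + 2 - Real.cos P - Real.cos Q =
    1 - Real.cos ω := mod_cast him
  push_cast at hre' him' ⊢
  simp only [one_mul, neg_mul, div_neg, div_I]
  linear_combination hre' - I * him' + (sin ω - sin P - sin Q) * I_sq

theorem angleCurve_biarcAngle {r : ℝ} (hr : 0 < r) (x : Plane) (φ : ℝ)
    {p : ℝ × ℝ × ℝ × ℝ × ℝ} (hp : p ∈ biarcParams ω) :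
    angleCurve x (fun t => φ + biarcAngle p (t / r)) (r * biarcLength p) =
      x + complexPlane (r * Complex.exp (φ * Complex.I) *
        ((1 - Complex.exp (-ω * Complex.I)) / Complex.I)) := by
  unfold angleCurve
  have : ∀ t : ℝ, Complex.exp ((φ + biarcAngle p (t / r) : ℝ) * Complex.I) =
      Complex.exp (φ * Complex.I) * Complex.exp (biarcAngle p (t / r) * Complex.I) := fun t => by
    rw [← Complex.exp_add, Complex.ofReal_add, add_mul]
  simp only [this]
  rw [intervalIntegral.integral_const_mul, intervalIntegral.integral_comp_div
    (fun u => Complex.exp (biarcAngle p u * Complex.I)) hr.ne', zero_div,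
    mul_div_cancel_left₀ _ hr.ne', integral_biarcAngle hp, Complex.real_smul]
  congr 2
  ring

/-- Length zero would force the displacement to vanish, against `sin ω < 0`. -/
theorem biarcLength_pos (h₁ : Real.pi < ω) (h₂ : ω < 2 * Real.pi) {p : ℝ × ℝ × ℝ × ℝ × ℝ}
    (hp : p ∈ biarcParams ω) : 0 < biarcLength p := by
  obtain ⟨A, P, B, Q, C⟩ := p
  obtain ⟨hA, hP, hB, hQ, hC, hre, -⟩ := mem_biarcParams.1 hp
  have hs := sin_neg_of_mem_Ioo h₁ h₂
  simp only [biarcLength]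
  by_contra! h
  obtain rfl : A = 0 := by linarith
  obtain rfl : P = 0 := by linarith
  obtain rfl : Q = 0 := by linarith
  obtain rfl : C = 0 := by linarith
  simp at hre
  linarith

end biarc

/-! ### Circular arcs and their comparison with the family -/

namespace ConstrainedCurve

open Complex

variable {κ r : ℝ} {x y a a₁ a₂ : Plane}

theorem eq_of_eqOn {σ γ : ConstrainedCurve κ x y} (hl : σ.length = γ.length)
    (h : EqOn σ.toFun γ.toFun (Icc 0 σ.length)) : σ = γ := by
  refine ConstrainedCurve.ext hl (funext fun t => ?_)
  rcases le_total t 0 with h0 | h0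
  · rw [σ.source t h0, γ.source t h0]
  rcases le_total σ.length t with h1 | h1
  · rw [σ.target t h1, γ.target t (hl ▸ h1)]
  · exact h ⟨h0, h1⟩

/-- The curve `σ` runs along the circle of centre `a` and radius `r`, from the angle `θ`, with
angular velocity `ε / r`. -/
def IsArc (a : Plane) (r θ ε : ℝ) (σ : ConstrainedCurve κ x y) : Prop :=
  ∀ t ∈ Icc 0 σ.length, σ.toFun t = a + complexPlane (r * exp ((θ + ε * (t / r) : ℝ) * I))

namespace IsArc

variable {θ ε θ₁ θ₂ : ℝ} {σ σ₁ σ₂ : ConstrainedCurve κ x y}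

theorem source_eq (h : σ.IsArc a r θ ε) : x = a + complexPlane (r * exp (θ * I)) := by
  simpa [σ.source 0 le_rfl] using h 0 ⟨le_rfl, σ.length_pos.le⟩

theorem toFun_eq (h : σ.IsArc a r θ ε) {t : ℝ} (ht : t ∈ Icc 0 σ.length) :
    σ.toFun t = x + complexPlane (r * exp (θ * I) * (exp (ε * (t / r) * I) - 1)) := by
  rw [h t ht, h.source_eq, add_assoc, ← map_add]
  congr 2
  push_cast
  rw [add_mul, exp_add]
  ring

theorem target_eq (h : σ.IsArc a r θ ε) :
    y = x + complexPlane (r * exp (θ * I) * (exp (ε * (σ.length / r) * I) - 1)) := by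
  have := h.toFun_eq ⟨σ.length_pos.le, le_rfl⟩
  rwa [σ.target _ le_rfl] at this

/-- The chord depends only on the central angle: reversing the direction conjugates the exponential.
-/
theorem norm_exp_sub_one (hr : 0 < r) (hε : ε = 1 ∨ ε = -1) (h : σ.IsArc a r θ ε) :
    r * ‖exp ((σ.length / r : ℝ) * I) - 1‖ = dist x y := by
  have hy : dist x y = r * ‖exp (ε * (σ.length / r) * I) - 1‖ := by
    rw [dist_comm, dist_eq_norm]
    nth_rw 1 [h.target_eq]
    rw [add_sub_cancel_left, LinearIsometryEquiv.norm_map, norm_mul, norm_mul,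
      norm_exp_ofReal_mul_I, mul_one, norm_real, Real.norm_of_nonneg hr.le]
  rw [hy]
  rcases hε with rfl | rfl
  · simp
  · rw [← norm_conj]
    congr 2
    simp [← exp_conj]

/-- The longer arcs of circles of the same radius have the same length. -/
theorem length_eq {ε₁ ε₂ : ℝ} (hr : 0 < r) (hε₁ : ε₁ = 1 ∨ ε₁ = -1) (hε₂ : ε₂ = 1 ∨ ε₂ = -1)
    (h₁ : σ₁.IsArc a₁ r θ₁ ε₁) (h₂ : σ₂.IsArc a₂ r θ₂ ε₂)
    (hl₁ : Real.pi * r < σ₁.length) (hl₁' : σ₁.length < 2 * Real.pi * r)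
    (hl₂ : Real.pi * r < σ₂.length) (hl₂' : σ₂.length < 2 * Real.pi * r) :
    σ₁.length = σ₂.length := by
  have hn := (h₁.norm_exp_sub_one hr hε₁).trans (h₂.norm_exp_sub_one hr hε₂).symm
  have hcos := cos_eq_of_norm_exp_sub_one_eq (mul_left_cancel₀ hr.ne' hn)
  -- The angles lie in `(π, 2π)`; their complements to `2π` lie in `[0, π]`, where the cosine is
  -- injective.
  rw [← Real.cos_two_pi_sub (σ₁.length / r), ← Real.cos_two_pi_sub (σ₂.length / r)] at hcos
  rw [← lt_div_iff₀ hr] at hl₁ hl₂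
  rw [← div_lt_iff₀ hr] at hl₁' hl₂'
  have := Real.injOn_cos ⟨by linarith, by linarith⟩ ⟨by linarith, by linarith⟩ hcos
  exact (div_left_inj' hr.ne').1 (by linarith)

/-- Equally long arcs from `x` to `y` in the same direction have the same centre. -/
theorem center_eq (hxy : 0 < dist x y) (h₁ : σ₁.IsArc a₁ r θ₁ ε) (h₂ : σ₂.IsArc a₂ r θ₂ ε)
    (hl : σ₁.length = σ₂.length) : a₁ = a₂ := by
  have e := h₂.target_eq
  nth_rw 1 [h₁.target_eq] at e
  rw [← hl] at e
  have e' := complexPlane.injective (add_left_cancel e)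
  have hne : exp (ε * (σ₁.length / r) * I) - 1 ≠ 0 := fun h0 => by
    have := h₁.target_eq
    rw [h0, mul_zero, map_zero, add_zero] at this
    exact hxy.ne' (by rw [this, dist_self])
  have := h₂.source_eq
  nth_rw 1 [h₁.source_eq] at this
  rw [mul_right_cancel₀ hne e'] at this
  exact add_right_cancel this

end IsArc

theorem angleCurve_affine {β : ℝ} (hβ : β ≠ 0) (x : Plane) (α : ℝ) {θ : ℝ → ℝ} {l t : ℝ}
    (ht : t ∈ Icc 0 l) (h : ∀ t ∈ Icc 0 l, θ t = α + β * t) :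
    angleCurve x θ t =
      x + complexPlane (exp (α * I) * (exp (β * t * I) - 1) / (β * I)) := by
  unfold angleCurve
  rw [integral_exp_mul_I_of_affine ht.1 hβ fun s hs => h s ⟨hs.1, hs.2.trans ht.2⟩,
    h t ht, h 0 ⟨le_rfl, ht.1.trans ht.2⟩]
  congr 3
  push_cast
  rw [add_mul, exp_add]
  ring_nf

theorem exp_ofReal_pi_div_two_mul_I : exp ((Real.pi / 2 : ℝ) * I) = I := by
  rw [exp_mul_I, ← ofReal_cos, ← ofReal_sin, Real.cos_pi_div_two, Real.sin_pi_div_two]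
  simp

/-- The longer arcs in opposite directions are joined by the curves with parameters in
`biarcParams`. -/
theorem joined_of_isArc {θ₁ θ₂ : ℝ} {σ₁ σ₂ : ConstrainedCurve (1 / r) x y} (hr : 0 < r)
    (hxy : 0 < dist x y) (h₁ : σ₁.IsArc a₁ r θ₁ 1) (h₂ : σ₂.IsArc a₂ r θ₂ (-1))
    (hl : σ₁.length = σ₂.length) (hl₁ : Real.pi * r < σ₁.length)
    (hl₂ : σ₁.length < 2 * Real.pi * r) : Joined σ₁ σ₂ := by
  set ω := σ₁.length / r with hω
  have hω₁ : Real.pi < ω := (lt_div_iff₀ hr).2 hl₁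
  have hω₂ : ω < 2 * Real.pi := (div_lt_iff₀ hr).2 hl₂
  have hlω : r * ω = σ₁.length := by rw [hω]; field_simp
  have hωc : (σ₁.length : ℂ) / r = ω := by rw [hω]; push_cast; rfl
  have hy := h₁.target_eq
  rw [hωc, ofReal_one, one_mul] at hy
  have hrc : (r : ℂ) ≠ 0 := ofReal_ne_zero.2 hr.ne'
  have hne : exp (ω * I) - 1 ≠ 0 := fun h0 => by
    rw [h0, mul_zero, map_zero, add_zero] at hy
    exact hxy.ne' (by rw [hy, dist_self])
  have hinv : exp (-ω * I) * exp (ω * I) = 1 := by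
    rw [← exp_add]
    simp
  -- Both arcs have the same displacement `y - x`; comparing the two formulas gives the starting
  -- angle of the second.
  have hθ : exp (θ₂ * I) = -(exp (θ₁ * I) * exp (ω * I)) := by
    have e := h₂.target_eq
    nth_rw 1 [hy] at e
    rw [← hl, hωc, ofReal_neg, ofReal_one, neg_one_mul] at e
    have e' := complexPlane.injective (add_left_cancel e)
    rw [mul_assoc, mul_assoc] at e'
    have e'' := mul_left_cancel₀ hrc e'
    refine mul_right_cancel₀ hne ?_
    linear_combination exp (ω * I) * e'' + exp (θ₂ * I) * hinv
  -- The tangent angle of the left arc at `y`; by `hθ` it is also that of the right arc at `x`.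
  set φ : ℝ := θ₁ + Real.pi / 2 + ω with hφ
  have hexpφ : exp (φ * I) = exp (θ₁ * I) * I * exp (ω * I) := by
    rw [hφ, ofReal_add, ofReal_add, add_mul, add_mul, exp_add, exp_add, exp_ofReal_pi_div_two_mul_I]
  have hend : ∀ p : biarcParams ω,
      angleCurve x (fun t => φ + biarcAngle p (t / r)) (r * biarcLength p) = y := fun p => by
    rw [angleCurve_biarcAngle hr x φ p.2, hy, hexpφ]
    congr 2
    generalize exp (-ω * I) = w at hinv ⊢
    generalize exp (ω * I) = z at hinv ⊢
    field_simp
    linear_combination -hinv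
  have hpos : ∀ p : biarcParams ω, 0 < r * biarcLength p := fun p =>
    mul_pos hr (biarcLength_pos hω₁ hω₂ p.2)
  have hcont : Continuous (Function.uncurry fun (p : biarcParams ω) (t : ℝ) =>
      φ + biarcAngle p (t / r)) := by
    refine continuous_const.add (continuous_biarcAngle.comp
      (f := fun q : biarcParams ω × ℝ => ((q.1 : ℝ × ℝ × ℝ × ℝ × ℝ), q.2 / r)) ?_)
    fun_prop
  have hlc : Continuous fun p : biarcParams ω => r * biarcLength p :=
    continuous_const.mul (continuous_biarcLength.comp continuous_subtype_val)
  have hH := continuous_ofAngle (κ := 1 / r) hpos hlc hcont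
    (fun p => piecewiseAffine_biarcAngle hr φ p.2) hend
  have hj := (joinedIn_biarcParams hω₁ hω₂).joined_subtype.map hH
  have hrc' : r⁻¹ ≠ 0 := inv_ne_zero hr.ne'
  have hle : ∀ {t : ℝ}, t ∈ Icc 0 (r * ω) → t / r ∈ Icc 0 ω := fun ht =>
    ⟨div_nonneg ht.1 hr.le, (div_le_iff₀ hr).2 (by linarith [ht.2])⟩
  -- The extreme parameters leave a single affine piece, of slope `1 / r` or `-1 / r`, which is the
  -- given arc.
  convert hj using 1
  · refine eq_of_eqOn (by simp [ofAngle, biarcLength, hlω]) fun t ht => ?_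
    rw [h₁.toFun_eq ht]
    rw [← hlω] at ht
    rw [ofAngle_toFun (by simpa [biarcLength] using ht), angleCurve_affine hrc' x (φ - ω) ht]
    · congr 2
      rw [ofReal_sub, sub_mul, exp_sub, hexpφ]
      push_cast
      have := exp_ne_zero (ω * I)
      field_simp
    · intro s hs
      have := (biarcAngle_pieces (A := 0) (P := ω) (B := 0) (Q := 0) (C := 0)
        (by linarith [Real.pi_pos]) le_rfl le_rfl).2.1 (s / r) (by simpa using hle hs)
      rw [this]
      ring
  · refine eq_of_eqOn (by simp [ofAngle, biarcLength, hlω, hl]) fun t ht => ?_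
    rw [h₂.toFun_eq ht]
    rw [← hl, ← hlω] at ht
    rw [ofAngle_toFun (by simpa [biarcLength] using ht),
      angleCurve_affine (neg_ne_zero.2 hrc') x φ ht]
    · congr 2
      rw [hθ, hexpφ]
      push_cast
      field_simp
    · intro s hs
      have := (biarcAngle_pieces (A := 0) (P := 0) (B := 0) (Q := ω) (C := 0)
        le_rfl le_rfl (by linarith [Real.pi_pos])).2.2.2.1 (s / r) (by simpa using hle hs)
      rw [this]
      ring

theorem homotopic_iff_joined {σ γ : ConstrainedCurve κ x y} : σ.Homotopic γ ↔ Joined σ γ :=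
  ⟨fun ⟨H, hH, h0, h1⟩ => ⟨⟨⟨H, hH⟩, h0, h1⟩⟩,
    fun ⟨H⟩ => ⟨H, H.continuous, H.source, H.target⟩⟩

theorem IsLongerArc.exists_isArc {σ : ConstrainedCurve κ x y} (h : σ.IsLongerArc a r) :
    ∃ θ ε : ℝ, (ε = 1 ∨ ε = -1) ∧ σ.IsArc a r θ ε := by
  obtain ⟨-, -, θ, ε, hε, h⟩ := h
  exact ⟨θ, ε, hε, fun t ht => by rw [h t ht, complexPlane_mul_exp]⟩

theorem exists_isLongerArc_of_angle (hr : 0 < r) {θ ε ω : ℝ} (hε : ε = 1 ∨ ε = -1)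
    (h₁ : Real.pi < ω) (h₂ : ω < 2 * Real.pi) (hx : x = a + complexPlane (r * exp (θ * I)))
    (hy : y = a + complexPlane (r * exp ((θ + ε * ω : ℝ) * I))) :
    ∃ σ : ConstrainedCurve (1 / r) x y, σ.IsLongerArc a r := by
  have habs : |ε| = 1 := by rcases hε with rfl | rfl <;> simp
  have hε0 : ε ≠ 0 := fun h => by simp [h] at habs
  have hl : 0 < r * ω := mul_pos hr (by linarith [Real.pi_pos])
  have hrc : (r : ℂ) ≠ 0 := ofReal_ne_zero.2 hr.ne'
  have hαε : exp ((θ + ε * (Real.pi / 2) : ℝ) * I) = exp (θ * I) * (ε * I) := by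
    rw [ofReal_add, add_mul, exp_add]
    congr 1
    rcases hε with rfl | rfl
    · rw [one_mul, exp_ofReal_pi_div_two_mul_I]
      simp
    · rw [neg_one_mul, ofReal_neg, neg_mul, exp_neg, exp_ofReal_pi_div_two_mul_I]
      simp
  -- On a circle the tangent is a quarter turn ahead of the radius, in the sense `ε` of the motion.
  set β := fun t : ℝ => (θ + ε * (Real.pi / 2)) + (ε / r) * t with hβ
  have hcurve : ∀ t ∈ Icc 0 (r * ω), angleCurve x β t =
      a + complexPlane (r * exp ((θ + ε * (t / r) : ℝ) * I)) := fun t ht => by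
    rw [angleCurve_affine (div_ne_zero hε0 hr.ne') x _ ht fun _ _ => rfl, hx, add_assoc,
      ← map_add, hαε]
    congr 2
    push_cast
    rw [add_mul, exp_add]
    have := ofReal_ne_zero.2 hε0
    field_simp
    ring
  have hκ : PiecewiseAffine (1 / r) β 0 (r * ω) :=
    .of_affine hl.le _ _ (by rw [abs_div, habs, abs_of_pos hr]) fun _ _ => rfl
  have hend : angleCurve x β (r * ω) = y := by
    rw [hcurve _ ⟨hl.le, le_rfl⟩, mul_div_cancel_left₀ _ hr.ne', hy]
  refine ⟨ofAngle x y β hl (by fun_prop) hκ hend, ?_, ?_, θ, ε, hε, fun t ht => ?_⟩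
  · change Real.pi * r < r * ω
    nlinarith
  · change r * ω < 2 * Real.pi * r
    nlinarith
  · have ht' : t ∈ Icc 0 (r * ω) := ht
    rw [ofAngle_toFun ht', hcurve t ht', complexPlane_mul_exp]

theorem exists_isLongerArc (hr : 0 < r) (hxy : 0 < dist x y) (hxy' : dist x y < 2 * r)
    (hx : x ∈ Metric.sphere a r) (hy : y ∈ Metric.sphere a r) :
    ∃ σ : ConstrainedCurve (1 / r) x y, σ.IsLongerArc a r := by
  have polar : ∀ z ∈ Metric.sphere a r, ∃ w : ℂ, ‖w‖ = r ∧ z = a + complexPlane w := by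
    intro z hz
    refine ⟨complexPlane.symm (z - a), ?_, by simp⟩
    rw [LinearIsometryEquiv.norm_map, ← dist_eq_norm]
    exact hz
  obtain ⟨u, hu, hxu⟩ := polar x hx
  obtain ⟨v, hv, hyv⟩ := polar y hy
  have hu0 : u ≠ 0 := fun h => by simp [h] at hu; exact hr.ne hu
  have hue : u = r * exp (u.arg * I) := by rw [← hu, norm_mul_exp_arg_mul_I]
  have hve : v = r * exp ((u.arg + (v / u).arg : ℝ) * I) := by
    have : v / u = exp ((v / u).arg * I) := by
      conv_lhs => rw [← norm_mul_exp_arg_mul_I (v / u), norm_div, hu, hv, div_self hr.ne',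
        ofReal_one, one_mul]
    rw [ofReal_add, add_mul, exp_add, ← this, ← mul_assoc, ← hue]
    field_simp
  set δ := (v / u).arg with hδ
  have hd : dist x y = ‖u - v‖ := by
    rw [hxu, hyv, dist_add_left, LinearIsometryEquiv.dist_map, dist_eq_norm]
  have hδ0 : δ ≠ 0 := fun h => by
    rw [h, add_zero, ← hue] at hve
    rw [hve, sub_self, norm_zero] at hd
    exact hxy.ne' hd
  have hδpi : δ ≠ Real.pi := fun h => by
    rw [h, ofReal_add, add_mul, exp_add, exp_pi_mul_I, mul_neg_one, mul_neg, ← hue] at hve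
    rw [hve, sub_neg_eq_add, ← two_mul, norm_mul, hu] at hd
    norm_num at hd
    linarith
  have hδ₁ : -Real.pi < δ := neg_pi_lt_arg _
  have hδ₂ : δ < Real.pi := (arg_le_pi _).lt_of_ne hδpi
  rw [hue] at hxu
  -- The short way from `x` to `y` turns by `δ`, so the longer arc turns the opposite way.
  rcases lt_or_gt_of_ne hδ0 with hneg | hpos
  · refine exists_isLongerArc_of_angle hr (ω := 2 * Real.pi + δ) (.inl rfl) (by linarith)
      (by linarith) hxu ?_
    rw [hyv, hve, exp_eq_exp_iff_exists_int.2 ⟨-1, ?_⟩]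
    push_cast
    ring
  · refine exists_isLongerArc_of_angle hr (ω := 2 * Real.pi - δ) (.inr rfl) (by linarith)
      (by linarith) hxu ?_
    rw [hyv, hve, exp_eq_exp_iff_exists_int.2 ⟨1, ?_⟩]
    push_cast
    ring

/-- Circles of which two points at distance less than the diameter form the intersection are
distinct. -/
theorem center_ne_of_inter_eq (hr : 0 < r) (hxy' : dist x y < 2 * r)
    (hC : Metric.sphere a₁ r ∩ Metric.sphere a₂ r = {x, y}) : a₁ ≠ a₂ := by
  rintro rfl
  rw [inter_self] at hC
  have hx : x ∈ Metric.sphere a₁ r := hC ▸ mem_insert x {y}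
  have hx' : ‖x - a₁‖ = r := by rw [← dist_eq_norm]; exact hx
  -- If the circles coincided, the antipode of `x` would have to be `x` or `y`, but it is at
  -- distance `2 * r`.
  have hm : a₁ - (x - a₁) ∈ Metric.sphere a₁ r := by
    rw [Metric.mem_sphere, dist_eq_norm, sub_sub_cancel_left, norm_neg, hx']
  have hdist : dist x (a₁ - (x - a₁)) = 2 * r := by
    rw [dist_eq_norm, show x - (a₁ - (x - a₁)) = (2 : ℝ) • (x - a₁) by module, norm_smul, hx']
    norm_num
  rw [hC] at hm
  rcases hm with h | h
  · rw [h, dist_self] at hdist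
    linarith
  · rw [mem_singleton_iff.1 h] at hdist
    linarith

end ConstrainedCurve

theorem mainTheorem6 (r : ℝ) (hr : 0 < r) (x y : Plane)
    (hd : 0 < dist x y) (hd' : dist x y < 2 * r)
    (a₁ a₂ : Plane) (hC : Metric.sphere a₁ r ∩ Metric.sphere a₂ r = {x, y}) :
    (∃ σ₁ : ConstrainedCurve (1 / r) x y, σ₁.IsLongerArc a₁ r) ∧
    (∃ σ₂ : ConstrainedCurve (1 / r) x y, σ₂.IsLongerArc a₂ r) ∧
    ∀ σ₁ σ₂ : ConstrainedCurve (1 / r) x y,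
      σ₁.IsLongerArc a₁ r → σ₂.IsLongerArc a₂ r → σ₁.Homotopic σ₂ := by
  have hx : x ∈ Metric.sphere a₁ r ∩ Metric.sphere a₂ r := hC ▸ mem_insert x {y}
  have hy : y ∈ Metric.sphere a₁ r ∩ Metric.sphere a₂ r := hC ▸ mem_insert_of_mem x rfl
  refine ⟨ConstrainedCurve.exists_isLongerArc hr hd hd' hx.1 hy.1,
    ConstrainedCurve.exists_isLongerArc hr hd hd' hx.2 hy.2, fun σ₁ σ₂ h₁ h₂ => ?_⟩
  have hne := ConstrainedCurve.center_ne_of_inter_eq hr hd' hC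
  obtain ⟨θ₁, ε₁, hε₁, k₁⟩ := h₁.exists_isArc
  obtain ⟨θ₂, ε₂, hε₂, k₂⟩ := h₂.exists_isArc
  have hl := k₁.length_eq hr hε₁ hε₂ k₂ h₁.1 h₁.2.1 h₂.1 h₂.2.1
  rw [ConstrainedCurve.homotopic_iff_joined]
  -- Arcs in the same direction would have the same centre, so only opposite directions remain.
  rcases hε₁ with rfl | rfl <;> rcases hε₂ with rfl | rfl
  · exact absurd (k₁.center_eq hd k₂ hl) hne
  · exact ConstrainedCurve.joined_of_isArc hr hd k₁ k₂ hl h₁.1 h₁.2.1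
  · exact (ConstrainedCurve.joined_of_isArc hr hd k₂ k₁ hl.symm h₂.1 h₂.2.1).symm
  · exact absurd (k₁.center_eq hd k₂ hl) hne
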